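/- Let $\Bbbk$ be a field. A bicomplex $M$ over $\Bbbk$ is a family of $\Bbbk$-vector spaces $M^{i,j}$ ($i,j\in\mathbb Z$; no finite-dimensionality assumed) with linear maps $\partial_1\colon M^{i,j}\to M^{i+1,j}$ and $\partial_2\colon M^{i,j}\to M^{i,j+1}$ such that $\partial_1^2=0$, $\partial_2^2=0$, $\partial_1\partial_2+\partial_2\partial_1=0$. Its total complex is $\mathrm{Tot}^n(M)=\bigoplus_{i+j=n}M^{i,j}$ with differential $d=\partial_1+\partial_2$, and its total cohomology is $H^n(\mathrm{Tot}(M))$. Call $M$ bounded from the Southeast if there are $a,b\in\mathbb Z$ with $M^{i,j}=0$ whenever $i\ge a$ and $j\le b$, and bounded from the Northwest if there are $a,b\in\mathbb Z$ with $M^{i,j}=0$ whenever $i\le a$ and $j\ge b$. For $p\in\mathbb Z$ let $F^p_{\mathrm{col}}H^n(\mathrm{Tot}(M))$ (respectively $F^p_{\mathrm{row}}H^n(\mathrm{Tot}(M))$) be the space of classes of cocycles lying in $\bigoplus_{i+j=n,\ i\ge p}M^{i,j}$ (respectively in $\bigoplus_{i+j=n,\ j\ge p}M^{i,j}$). (1)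 If $M$ is bounded from the Southeast, there is a spectral sequence $(E_r^{i,j},d_r)_{r\ge 1}$ of $\Bbbk$-vector spaces, with $d_r\colon E_r^{i,j}\to E_r^{i+r,\,j-r+1}$, whose first page is isomorphic to $(H(M,\partial_2),\partial_1)$, i.e. $E_1^{i,j}\cong H^{i,j}(M,\partial_2)$ with $d_1$ corresponding to the map induced by $\partial_1$, and which converges to the total cohomology of $M$ with the filtration $F_{\mathrm{col}}$: $E_\infty^{i,j}\cong F^i_{\mathrm{col}}H^{i+j}(\mathrm{Tot}(M))/F^{i+1}_{\mathrm{col}}H^{i+j}(\mathrm{Tot}(M))$ for all $i,j$. (2) If $M$ is bounded from the Northwest, there is a spectral sequence $(E_r^{i,j},d_r)_{r\ge 1}$ of $\Bbbk$-vector spaces, with $d_r\colon E_r^{i,j}\to E_r^{i-r+1,\,j+r}$, whose first page is isomorphic to $(H(M,\partial_1),\partial_2)$, and which converges to the total cohomology of $M$ with the filtration $F_{\mathrm{row}}$: $E_\infty^{i,j}\cong F^j_{\mathrm{row}}H^{i+j}(\mathrm{Tot}(M))/F^{j+1}_{\mathrm{row}}H^{i+j}(\mathrm{Tot}(M))$ for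 all $i,j$. Here $E_\infty^{i,j}=Z_\infty^{i,j}/B_\infty^{i,j}$, where $Z_\infty^{i,j}\subseteq E_1^{i,j}$ consists of the elements that survive to every page and $B_\infty^{i,j}$ of those that survive to some page and become zero there. Convergence includes that, for each $(i,j)$, the differential $d_r$ leaving $E_r^{i,j}$ vanishes for all sufficiently large $r$, and that for each $n$ the filtration $F^\bullet H^n(\mathrm{Tot}(M))$ is decreasing, has union $H^n(\mathrm{Tot}(M))$, and satisfies $F^pH^n(\mathrm{Tot}(M))=0$ for some $p$. -/

import Mathlib

open CategoryTheory
open scoped DirectSum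

universe u v

noncomputable section

/-- A bicomplex of `k`-vector spaces: spaces `X i j` for `i j : ℤ`, with anticommuting differentials
`∂₁ : X i j ⟶ X (i+1) j` and `∂₂ : X i j ⟶ X i (j+1)`. The target index is a separate variable with
an equation (`i + 1 = i'`), which is the same data and avoids transports along equalities. -/
structure Bicomplex (k : Type u) [Field k] where
  X : ℤ → ℤ → ModuleCat.{v} k
  d₁ : ∀ i i' j : ℤ, i + 1 = i' → (X i j ⟶ X i' j)
  d₂ : ∀ i j j' : ℤ, j + 1 = j' → (X i j ⟶ X i j')
  d₁_d₁ : ∀ (i i' i'' j : ℤ) (h : i + 1 = i') (h' : i' + 1 = i''),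
    d₁ i i' j h ≫ d₁ i' i'' j h' = 0
  d₂_d₂ : ∀ (i j j' j'' : ℤ) (h : j + 1 = j') (h' : j' + 1 = j''),
    d₂ i j j' h ≫ d₂ i j' j'' h' = 0
  anticomm : ∀ (i i' j j' : ℤ) (h : i + 1 = i') (h' : j + 1 = j'),
    d₂ i j j' h' ≫ d₁ i i' j' h + d₁ i i' j h ≫ d₂ i' j j' h' = 0

namespace Bicomplex

variable {k : Type u} [Field k] (M : Bicomplex.{u, v} k)

/-- `M^{i,j} = 0` whenever `i ≫ 0` and `j ≪ 0`. -/
def BoundedFromSoutheast : Prop :=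
  ∃ a b : ℤ, ∀ i j : ℤ, a ≤ i → j ≤ b → Subsingleton (M.X i j)

/-- `M^{i,j} = 0` whenever `i ≪ 0` and `j ≫ 0`. -/
def BoundedFromNorthwest : Prop :=
  ∃ a b : ℤ, ∀ i j : ℤ, i ≤ a → b ≤ j → Subsingleton (M.X i j)

/-! ### Cohomology with respect to one differential -/

/-- `M^{i,j-1} ⟶ M^{i,j} ⟶ M^{i,j+1}` with the maps `∂₂`. -/
def sc₂ (i j : ℤ) : ShortComplex (ModuleCat.{v} k) :=
  ShortComplex.mk (M.d₂ i (j - 1) j (by lia)) (M.d₂ i j (j + 1) rfl) (M.d₂_d₂ _ _ _ _ _ _)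

/-- `M^{i-1,j} ⟶ M^{i,j} ⟶ M^{i+1,j}` with the maps `∂₁`. -/
def sc₁ (i j : ℤ) : ShortComplex (ModuleCat.{v} k) :=
  ShortComplex.mk (M.d₁ (i - 1) i j (by lia)) (M.d₁ i (i + 1) j rfl) (M.d₁_d₁ _ _ _ _ _ _)

/-- `H^{i,j}(M, ∂₂)`. -/
def H₂ (i j : ℤ) : ModuleCat.{v} k := (M.sc₂ i j).homology

/-- `H^{i,j}(M, ∂₁)`. -/
def H₁ (i j : ℤ) : ModuleCat.{v} k := (M.sc₁ i j).homology

/-- `∂₁` in the middle; the outer signs account for the anticommutation. -/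
def sc₂Map (i j : ℤ) : M.sc₂ i j ⟶ M.sc₂ (i + 1) j where
  τ₁ := -M.d₁ i (i + 1) (j - 1) rfl
  τ₂ := M.d₁ i (i + 1) j rfl
  τ₃ := -M.d₁ i (i + 1) (j + 1) rfl
  comm₁₂ := by
    have h := M.anticomm i (i + 1) (j - 1) j rfl (by lia)
    simpa [sc₂] using (eq_neg_of_add_eq_zero_left h).symm
  comm₂₃ := by
    have h := M.anticomm i (i + 1) j (j + 1) rfl rfl
    simpa [sc₂] using eq_neg_of_add_eq_zero_right h

/-- `∂₂` in the middle; the outer signs account for the anticommutation. -/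
def sc₁Map (i j : ℤ) : M.sc₁ i j ⟶ M.sc₁ i (j + 1) where
  τ₁ := -M.d₂ (i - 1) j (j + 1) rfl
  τ₂ := M.d₂ i j (j + 1) rfl
  τ₃ := -M.d₂ (i + 1) j (j + 1) rfl
  comm₁₂ := by
    have h := M.anticomm (i - 1) i j (j + 1) (by lia) rfl
    simpa [sc₁] using (eq_neg_of_add_eq_zero_right h).symm
  comm₂₃ := by
    have h := M.anticomm i (i + 1) j (j + 1) rfl rfl
    simpa [sc₁] using eq_neg_of_add_eq_zero_left h

/-- The map `H^{i,j}(M, ∂₂) ⟶ H^{i+1,j}(M, ∂₂)` induced by `∂₁`. -/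
def inducedD₁ (i j : ℤ) : M.H₂ i j ⟶ M.H₂ (i + 1) j :=
  ShortComplex.homologyMap (M.sc₂Map i j)

/-- The map `H^{i,j}(M, ∂₁) ⟶ H^{i,j+1}(M, ∂₁)` induced by `∂₂`. -/
def inducedD₂ (i j : ℤ) : M.H₁ i j ⟶ M.H₁ i (j + 1) :=
  ShortComplex.homologyMap (M.sc₁Map i j)

/-! ### The total complex -/

/-- `Tot^n(M)`, the direct sum of the `M^{i,j}` with `i + j = n`. -/
abbrev Tot (n : ℤ) : Type v :=
  ⨁ x : {x : ℤ × ℤ // x.1 + x.2 = n}, M.X x.1.1 x.1.2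

/-- The inclusion of the summand `M^{i,j}` in `Tot^n(M)`, where `i + j = n`. -/
def ιTot (i j n : ℤ) (h : i + j = n) : M.X i j →ₗ[k] M.Tot n :=
  DirectSum.lof k {x : ℤ × ℤ // x.1 + x.2 = n} (fun x => M.X x.1.1 x.1.2) ⟨(i, j), h⟩

/-- The total differential `∂₁ + ∂₂`. -/
def totD (n n' : ℤ) (h : n + 1 = n') : M.Tot n →ₗ[k] M.Tot n' :=
  DirectSum.toModule k _ _ fun x =>
    M.ιTot (x.1.1 + 1) x.1.2 n' (by have := x.2; lia) ∘ₗ (M.d₁ x.1.1 (x.1.1 + 1) x.1.2 rfl).hom +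
    M.ιTot x.1.1 (x.1.2 + 1) n' (by have := x.2; lia) ∘ₗ (M.d₂ x.1.1 x.1.2 (x.1.2 + 1) rfl).hom

lemma totD_ιTot (i j n n' : ℤ) (h : i + j = n) (h' : n + 1 = n') (m : M.X i j) :
    M.totD n n' h' (M.ιTot i j n h m) =
      M.ιTot (i + 1) j n' (by lia) ((M.d₁ i (i + 1) j rfl).hom m) +
      M.ιTot i (j + 1) n' (by lia) ((M.d₂ i j (j + 1) rfl).hom m) := by
  simp only [totD, ιTot, DirectSum.toModule_lof]
  rfl

lemma totD_totD (n n' n'' : ℤ) (h : n + 1 = n') (h' : n' + 1 = n'') :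
    M.totD n' n'' h' ∘ₗ M.totD n n' h = 0 := by
  apply DirectSum.linearMap_ext
  rintro ⟨⟨i, j⟩, hij⟩
  refine LinearMap.ext fun m => ?_
  change M.totD n' n'' h' (M.totD n n' h (M.ιTot i j n hij m)) = 0
  have e₁ := congrArg (fun f => f.hom m) (M.d₁_d₁ i (i + 1) (i + 1 + 1) j rfl rfl)
  have e₂ := congrArg (fun f => f.hom m) (M.d₂_d₂ i j (j + 1) (j + 1 + 1) rfl rfl)
  have e₃ := congrArg (fun f => f.hom m) (M.anticomm i (i + 1) j (j + 1) rfl rfl)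
  simp only [ModuleCat.hom_comp, ModuleCat.hom_add, ModuleCat.hom_zero, LinearMap.comp_apply,
    LinearMap.add_apply, LinearMap.zero_apply] at e₁ e₂ e₃
  rw [totD_ιTot, map_add, totD_ιTot, totD_ιTot, e₁, e₂, map_zero, map_zero, zero_add, add_zero,
    ← map_add, (add_comm _ _).trans e₃, map_zero]

/-- The total complex `(Tot(M), ∂₁ + ∂₂)`. -/
def total : CochainComplex (ModuleCat.{v} k) ℤ where
  X n := ModuleCat.of k (M.Tot n)
  d n n' := if h : n + 1 = n' then ModuleCat.ofHom (M.totD n n' h) else 0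
  shape n n' h := dif_neg h
  d_comp_d' n n' n'' h h' := by
    obtain rfl : n + 1 = n' := h
    obtain rfl : n + 1 + 1 = n'' := h'
    rw [dif_pos rfl, dif_pos rfl, ← ModuleCat.ofHom_comp, totD_totD]
    rfl

/-- The total cohomology `H^n(Tot(M), ∂₁ + ∂₂)`. -/
def totalCohomology (n : ℤ) : ModuleCat.{v} k := M.total.homology n

/-- The elements of `Tot^n(M)` all of whose components outside `S` vanish. -/
def supportedIn (S : Set (ℤ × ℤ)) (n : ℤ) : Submodule k (M.total.X n) where
  carrier := {t | ∀ x : {x : ℤ × ℤ // x.1 + x.2 = n}, x.1 ∉ S → (show M.Tot n from t) x = 0}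
  zero_mem' _ _ := rfl
  add_mem' {a b} ha hb x hx := by
    change (show M.Tot n from a) x + (show M.Tot n from b) x = 0
    rw [ha x hx, hb x hx, add_zero]
  smul_mem' c a ha x hx := by
    change c • (show M.Tot n from a) x = 0
    rw [ha x hx, smul_zero]

/-- The classes in `H^n(Tot(M))` that are represented by a cocycle supported in `S`. -/
def classesSupportedIn (S : Set (ℤ × ℤ)) (n : ℤ) : Submodule k (M.totalCohomology n) :=
  ((M.supportedIn S n).comap (M.total.iCycles n).hom).map (M.total.homologyπ n).hom

/-- The filtration of `H^n(Tot(M))` by columns: the classes of cocycles in `⨁_{i ≥ p} M^{i,n-i}`. -/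
def columnFiltration (p n : ℤ) : Submodule k (M.totalCohomology n) :=
  M.classesSupportedIn {x | p ≤ x.1} n

/-- The filtration of `H^n(Tot(M))` by rows: the classes of cocycles in `⨁_{j ≥ p} M^{n-j,j}`. -/
def rowFiltration (p n : ℤ) : Submodule k (M.totalCohomology n) :=
  M.classesSupportedIn {x | p ≤ x.2} n

end Bicomplex

/-! ### The limit page and convergence of a spectral sequence of vector spaces -/

namespace SpecSeq

variable {k : Type u} [Field k] {κ : Type} {c : ℤ → ComplexShape κ} {r₀ : ℤ}
  (E : SpectralSequence (ModuleCat.{v} k) c r₀)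

/-- For a subspace `S` of `E_{r+1}` at `x`, the subspace of `E_r` at `x` that consists of the
elements killed by the differential of `E_r` and whose class in `E_{r+1}` lies in `S`. -/
def pullback (x : κ) (r : ℤ) (hr : r₀ ≤ r)
    (S : Submodule k ((E.page (r + 1) (by lia)).X x)) : Submodule k ((E.page r hr).X x) :=
  (S.comap ((E.page r hr).homologyπ x ≫ (E.iso r (r + 1) x rfl hr).hom).hom).map
    ((E.page r hr).iCycles x).hom

/-- The subspace of `E_r` of the elements that survive to `E_{r+n}`. -/
def surviving (x : κ) : ∀ (_ : ℕ) (r : ℤ) (hr : r₀ ≤ r), Submodule k ((E.page r hr).X x)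
  | 0, _, _ => ⊤
  | n + 1, r, hr => pullback E x r hr (surviving x n (r + 1) (by lia))

/-- The subspace of `E_r` of the elements that survive to `E_{r+n}` and become zero there. -/
def dying (x : κ) : ∀ (_ : ℕ) (r : ℤ) (hr : r₀ ≤ r), Submodule k ((E.page r hr).X x)
  | 0, _, _ => ⊥
  | n + 1, r, hr => pullback E x r hr (dying x n (r + 1) (by lia))

/-- The permanent cycles `Z_∞ = ⋂ Z_r` in the first page. -/
def permanentCycles (x : κ) : Submodule k ((E.page r₀ le_rfl).X x) :=
  ⨅ n : ℕ, surviving E x n r₀ le_rfl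

/-- The eventual boundaries `B_∞ = ⋃ B_r` in the first page (an increasing union). -/
def eventualBoundaries (x : κ) : Submodule k ((E.page r₀ le_rfl).X x) :=
  ⨆ n : ℕ, dying E x n r₀ le_rfl

/-- `E_∞ = Z_∞ / B_∞`. -/
abbrev EInfty (x : κ) : Type v :=
  permanentCycles E x ⧸ (eventualBoundaries E x).submoduleOf (permanentCycles E x)

/-- The associated graded piece `F^p H^n / F^{p+1} H^n` of a decreasing filtration. -/
abbrev gr {H : ℤ → ModuleCat.{v} k} (F : ∀ _ n : ℤ, Submodule k (H n)) (p n : ℤ) : Type v :=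
  F p n ⧸ (F (p + 1) n).submoduleOf (F p n)

/-- Convergence of a spectral sequence to a graded space `H` with filtration `F`. Here `fil x` and
`deg x` are the filtration degree and the total degree of the position `x`. -/
structure ConvergesTo (fil deg : κ → ℤ) (H : ℤ → ModuleCat.{v} k)
    (F : ∀ _ n : ℤ, Submodule k (H n)) : Prop where
  /-- For each position, the differentials that leave it vanish on all sufficiently late pages. -/
  regular : ∀ x, ∃ R : ℤ, ∀ (r : ℤ) (hr : r₀ ≤ r), R ≤ r → ∀ y, (E.page r hr).d x y = 0
  decreasing : ∀ p n, F (p + 1) n ≤ F p n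
  exhaustive : ∀ n, ⨆ p, F p n = ⊤
  /-- In each degree the filtration reaches zero; so it is Hausdorff and complete. -/
  terminates : ∀ n, ∃ p, F p n = ⊥
  /-- `E_∞` is the associated graded space of the filtration. -/
  limit : ∀ x, Nonempty (EInfty E x ≃ₗ[k] gr F (fil x) (deg x))

end SpecSeq

end

/-! Both statements are the spectral sequence of a filtered complex, for the filtration F of Tot(M)
by columns or by rows. Put Z_r^p = {a ∈ F^p : da ∈ F^{p+r}} and E_r^p = Z_r^p / (Z_{r-1}^{p+1} + d
Z_{r-1}^{p-r+1}), with d_r induced by d. The cycles of d_r are the classes of elements of Z_{r+1}^p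
(`range_nextCycles`), and such a class is a boundary exactly when it vanishes in E_{r+1}
(`nextCycles_mem_range_iff`); hence H(E_r) = E_{r+1}. On E_1 only the graded pieces matter: these
are the columns with ∂₂, or the rows with ∂₁ (`GradedChart.exists_iso`), and the other differential
induces d_1 (`GradedChart.page_d_iso`).

Convergence uses two facts. The vanishing corner of M gives F^p Tot^n = 0 for large p, so a class
that survives to every page is represented by a genuine cocycle in F^p. An element of a direct sum
has finite support, so every cochain lies in some F^q, and B_∞ catches every coboundary. Thus E_∞
and F^pH/F^{p+1}H are quotients of the same space, the cocycles z in F^p, by the same kernel: z = y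
+ dw with y a cocycle in F^{p+1} (`cls_mem_eventualBoundaries_iff`, `toGr_eq_zero_iff`). No bound is
needed at the other end of the filtration, since B_∞ is a union that no finite page has to attain.

All degrees live inside one module T, here the product of all M^{i,j}, so that no element is
transported between equal degrees. The product is only ambient: F consists of images of elements of
the direct sum. -/

open CategoryTheory
open scoped DirectSum

noncomputable section

/-! ### Homology of short complexes of modules from a presentation -/

namespace CategoryTheory.ShortComplex

variable {k : Type u} [Field k]

/-- Two cycles have the same homology class exactly when they differ by a boundary. -/
lemma moduleCat_homologyπ_eq_iff (S : ShortComplex (ModuleCat.{v} k)) (c c' : S.cycles) :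
    S.homologyπ c = S.homologyπ c' ↔
      S.iCycles c - S.iCycles c' ∈ LinearMap.range S.f.hom := by
  -- Homology embeds in the opcycles X₂ / im f, where equality means differing by an element of im
  -- f.
  rw [← S.moduleCat_pOpcycles_eq_iff]
  have h (c : S.cycles) : S.pOpcycles (S.iCycles c) = S.homologyι (S.homologyπ c) := by
    rw [← ConcreteCategory.comp_apply, ← ConcreteCategory.comp_apply, S.homology_π_ι]
  rw [h, h]
  exact ((ModuleCat.mono_iff_injective S.homologyι).1 inferInstance).eq_iff.symm

lemma moduleCat_iCycles_injective (S : ShortComplex (ModuleCat.{v} k)) :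
    Function.Injective S.iCycles :=
  (ModuleCat.mono_iff_injective _).1 inferInstance

lemma moduleCat_homologyπ_surjective (S : ShortComplex (ModuleCat.{v} k)) :
    Function.Surjective S.homologyπ :=
  (ModuleCat.epi_iff_surjective _).1 inferInstance

lemma moduleCat_g_iCycles (S : ShortComplex (ModuleCat.{v} k)) (c : S.cycles) :
    S.g (S.iCycles c) = 0 := by
  rw [← ConcreteCategory.comp_apply, S.iCycles_g]; rfl

lemma moduleCat_exists_iCycles_eq (S : ShortComplex (ModuleCat.{v} k)) (m : S.X₂)
    (h : S.g m = 0) : ∃ c : S.cycles, S.iCycles c = m := by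
  exact ⟨S.moduleCatCyclesIso.inv ⟨m, h⟩,
    congrArg (fun f => f.hom ⟨m, h⟩) S.moduleCatCyclesIso_inv_iCycles⟩

/-- If `a` maps `A` onto the cycles of `S`, and the preimage of the boundaries is the kernel of
a surjection `q : A → N`, then `N` is the homology of `S`. -/
lemma moduleCat_exists_homologyIso (S : ShortComplex (ModuleCat.{v} k)) {A : Type v}
    [AddCommGroup A] [Module k A] (N : ModuleCat.{v} k) (a : A →ₗ[k] S.X₂) (q : A →ₗ[k] N)
    (hq : Function.Surjective q) (ha : LinearMap.range a = LinearMap.ker S.g.hom)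
    (haq : ∀ z, a z ∈ LinearMap.range S.f.hom ↔ q z = 0) :
    ∃ e : S.homology ≅ N, ∀ (z : A) (c : S.cycles), S.iCycles c = a z →
      e.hom (S.homologyπ c) = q z := by
  have hg (z : A) : S.g (a z) = 0 := by
    have : a z ∈ LinearMap.ker S.g.hom := ha ▸ LinearMap.mem_range_self a z
    exact this
  let l : A →ₗ[k] S.homology := S.homologyπ.hom ∘ₗ S.moduleCatCyclesIso.inv.hom ∘ₗ
    a.codRestrict (LinearMap.ker S.g.hom) hg
  have hl (z : A) (c : S.cycles) (h : S.iCycles c = a z) : l z = S.homologyπ c := by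
    refine (S.moduleCat_homologyπ_eq_iff _ c).2 ?_
    have : S.iCycles (S.moduleCatCyclesIso.inv ⟨a z, hg z⟩) = a z :=
      congrArg (fun f => f.hom ⟨a z, hg z⟩) S.moduleCatCyclesIso_inv_iCycles
    change S.iCycles (S.moduleCatCyclesIso.inv ⟨a z, hg z⟩) - _ ∈ _
    rw [this, h, sub_self]
    exact zero_mem _
  have hls : Function.Surjective l := by
    intro y
    obtain ⟨c, rfl⟩ := S.moduleCat_homologyπ_surjective y
    have : S.iCycles c ∈ LinearMap.range a := by
      rw [ha]; exact S.moduleCat_g_iCycles c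
    obtain ⟨z, hz⟩ := this
    exact ⟨z, hl z c hz.symm⟩
  have hk : LinearMap.ker l = LinearMap.ker q := by
    ext z
    obtain ⟨c, hc⟩ := S.moduleCat_exists_iCycles_eq (a z) (hg z)
    rw [LinearMap.mem_ker, LinearMap.mem_ker, hl z c hc, ← haq, ← hc,
      ← map_zero S.homologyπ.hom]
    refine (S.moduleCat_homologyπ_eq_iff c 0).trans ?_
    rw [map_zero, sub_zero]
  let e : S.homology ≃ₗ[k] N := (l.quotKerEquivOfSurjective hls).symm ≪≫ₗ
    Submodule.quotEquivOfEq _ _ hk ≪≫ₗ q.quotKerEquivOfSurjective hq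
  refine ⟨e.toModuleIso, fun z c h => ?_⟩
  change e (S.homologyπ c) = q z
  rw [← hl z c h]
  have : (l.quotKerEquivOfSurjective hls).symm (l z) = Submodule.Quotient.mk z := by
    rw [LinearEquiv.symm_apply_eq]; rfl
  simp only [e, LinearEquiv.trans_apply, this]
  rfl

end CategoryTheory.ShortComplex

/-! ### Filtered differential modules -/

/-- A module `T` with a differential, and subspaces `F p n` (the part in degree `n` and in
filtration `≥ p`) such that the differential has degree one and respects the filtration. -/
structure FilteredDifferential (k : Type u) [Field k] (T : Type v) [AddCommGroup T]
    [Module k T] where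
  d : T →ₗ[k] T
  F : ℤ → ℤ → Submodule k T
  d_d : ∀ a, d (d a) = 0
  F_succ_le : ∀ p n, F (p + 1) n ≤ F p n
  d_mem : ∀ p n, ∀ a ∈ F p n, d a ∈ F p (n + 1)

namespace FilteredDifferential

variable {k : Type u} [Field k] {T : Type v} [AddCommGroup T] [Module k T]
  (Φ : FilteredDifferential k T)

lemma F_anti (n : ℤ) : Antitone fun p => Φ.F p n :=
  antitone_int_of_succ_le fun p => Φ.F_succ_le p n

variable {Φ} in
lemma F_mono {p q n m : ℤ} {a : T} (ha : a ∈ Φ.F p n) (hp : q ≤ p) (hn : n = m) :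
    a ∈ Φ.F q m := by
  subst hn
  exact Φ.F_anti n hp ha

/-! ### Cycles, boundaries and pages -/

/-- The elements of filtration `p` whose differential has filtration `p + r`. -/
def Z (r p n : ℤ) : Submodule k T := Φ.F p n ⊓ (Φ.F (p + r) (n + 1)).comap Φ.d

/-- The elements of `Z r p n` that become zero in the `r`-th page. -/
def D (r p n : ℤ) : Submodule k T :=
  Φ.Z (r - 1) (p + 1) n ⊔ (Φ.Z (r - 1) (p - r + 1) (n - 1)).map Φ.d

/-- The elements of filtration `p` that are the differential of an element of filtration
`p - r + 1`. -/
def B (r p n : ℤ) : Submodule k T := Φ.F p n ⊓ (Φ.F (p - r + 1) (n - 1)).map Φ.d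

lemma mem_Z {r p n : ℤ} {a : T} :
    a ∈ Φ.Z r p n ↔ a ∈ Φ.F p n ∧ Φ.d a ∈ Φ.F (p + r) (n + 1) := Iff.rfl

lemma mem_D {r p n : ℤ} {a : T} :
    a ∈ Φ.D r p n ↔ ∃ y w, y ∈ Φ.F (p + 1) n ∧ Φ.d y ∈ Φ.F (p + r) (n + 1) ∧
      w ∈ Φ.F (p - r + 1) (n - 1) ∧ Φ.d w ∈ Φ.F p n ∧ y + Φ.d w = a := by
  have e₁ : p + 1 + (r - 1) = p + r := by ring
  have e₂ : p - r + 1 + (r - 1) = p := by ring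
  simp only [D, Submodule.mem_sup, Submodule.mem_map, mem_Z, e₁, e₂, sub_add_cancel]
  constructor
  · rintro ⟨y, ⟨h₁, h₂⟩, _, ⟨w, ⟨h₃, h₄⟩, rfl⟩, rfl⟩
    exact ⟨y, w, h₁, h₂, h₃, h₄, rfl⟩
  · rintro ⟨y, w, h₁, h₂, h₃, h₄, rfl⟩
    exact ⟨y, ⟨h₁, h₂⟩, _, ⟨w, ⟨h₃, h₄⟩, rfl⟩, rfl⟩

lemma D_le_Z (r p n : ℤ) : Φ.D r p n ≤ Φ.Z r p n := by
  intro a ha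
  obtain ⟨y, w, hy, hdy, -, hdw, rfl⟩ := Φ.mem_D.1 ha
  refine Φ.mem_Z.2 ⟨add_mem (F_mono hy (by lia) rfl) hdw, ?_⟩
  rwa [map_add, Φ.d_d, add_zero]

lemma Z_anti {r s : ℤ} (h : r ≤ s) (p n : ℤ) : Φ.Z s p n ≤ Φ.Z r p n :=
  fun _ ha => ⟨ha.1, F_mono ha.2 (by lia) rfl⟩

/-- The term of the `r`-th page in filtration degree `p` and total degree `n`. -/
abbrev PageX (r p n : ℤ) : Type v := Φ.Z r p n ⧸ (Φ.D r p n).submoduleOf (Φ.Z r p n)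

/-- The class of an element of `Z r p n` in the `r`-th page. -/
def cls (r p n : ℤ) : Φ.Z r p n →ₗ[k] Φ.PageX r p n := Submodule.mkQ _

lemma cls_surjective (r p n : ℤ) : Function.Surjective (Φ.cls r p n) := Submodule.mkQ_surjective _

lemma cls_eq_zero {r p n : ℤ} (z : Φ.Z r p n) : Φ.cls r p n z = 0 ↔ (z : T) ∈ Φ.D r p n :=
  Submodule.Quotient.mk_eq_zero _

lemma cls_eq_cls {r p n : ℤ} (z z' : Φ.Z r p n) :
    Φ.cls r p n z = Φ.cls r p n z' ↔ (z - z' : T) ∈ Φ.D r p n :=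
  Submodule.Quotient.eq _

lemma ker_d_le_Z (r p n : ℤ) : Φ.F p n ⊓ LinearMap.ker Φ.d ≤ Φ.Z r p n := by
  refine fun z hz => ⟨hz.1, ?_⟩
  change Φ.d z ∈ Φ.F (p + r) (n + 1)
  rw [show Φ.d z = 0 from hz.2]
  exact zero_mem _

lemma d_mem_Z {r p n p' n' : ℤ} (hp : p + r = p') (hn : n + 1 = n') {a : T}
    (ha : a ∈ Φ.Z r p n) : Φ.d a ∈ Φ.Z r p' n' := by
  subst hp hn
  refine Φ.mem_Z.2 ⟨ha.2, ?_⟩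
  rw [Φ.d_d]
  exact zero_mem _

/-- For y + dw in D, the differential is dy, so y itself becomes the element whose boundary is taken
in the target. -/
lemma d_mem_D {r p n p' n' : ℤ} (hp : p + r = p') (hn : n + 1 = n') {a : T}
    (ha : a ∈ Φ.D r p n) : Φ.d a ∈ Φ.D r p' n' := by
  subst hp hn
  obtain ⟨y, w, hy, hdy, -, -, rfl⟩ := Φ.mem_D.1 ha
  refine Φ.mem_D.2 ⟨0, y, zero_mem _, ?_, F_mono hy (by lia) (by lia), hdy, ?_⟩
  · rw [map_zero]; exact zero_mem _
  · rw [map_add, Φ.d_d, add_zero, zero_add]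

/-- The differential of the `r`-th page. -/
def pageD (r : ℤ) {p n p' n' : ℤ} (hp : p + r = p') (hn : n + 1 = n') :
    Φ.PageX r p n →ₗ[k] Φ.PageX r p' n' :=
  Submodule.mapQ _ _ (Φ.d.restrict fun _ ha => Φ.d_mem_Z hp hn ha) fun _ ha =>
    Φ.d_mem_D hp hn ha

lemma pageD_pageD (r : ℤ) {p n p' n' p'' n'' : ℤ} (hp : p + r = p') (hn : n + 1 = n')
    (hp' : p' + r = p'') (hn' : n' + 1 = n'') (x : Φ.PageX r p n) :
    Φ.pageD r hp' hn' (Φ.pageD r hp hn x) = 0 := by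
  obtain ⟨z, rfl⟩ := Φ.cls_surjective r p n x
  refine (Φ.cls_eq_zero _).2 ?_
  change Φ.d (Φ.d z) ∈ _
  rw [Φ.d_d]
  exact zero_mem _

/-- The elements of `Z (r + 1) p n`, viewed in the `r`-th page. -/
def nextCycles (r p n : ℤ) : Φ.Z (r + 1) p n →ₗ[k] Φ.PageX r p n :=
  Φ.cls r p n ∘ₗ Submodule.inclusion (Φ.Z_anti (by lia) p n)

/-- If dz = y + dw vanishes in E_r, then z - w has differential y, one filtration step deeper, and w
∈ Z_{r-1}^{p+1} does not affect the class of z. -/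
lemma range_nextCycles (r : ℤ) {p n p' n' : ℤ} (hp : p + r = p') (hn : n + 1 = n') :
    LinearMap.range (Φ.nextCycles r p n) = LinearMap.ker (Φ.pageD r hp hn) := by
  subst hp hn
  apply le_antisymm
  · rintro _ ⟨z, rfl⟩
    refine (Φ.cls_eq_zero _).2 (Φ.mem_D.2 ⟨Φ.d z, 0, F_mono z.2.2 (by lia) rfl, ?_, zero_mem _,
      ?_, ?_⟩)
    · rw [Φ.d_d]; exact zero_mem _
    · rw [map_zero]; exact zero_mem _
    · rw [map_zero, add_zero]; rfl
  · intro x hx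
    obtain ⟨z, rfl⟩ := Φ.cls_surjective r p n x
    obtain ⟨y, w, hy, -, hw, hdw, h⟩ := Φ.mem_D.1 ((Φ.cls_eq_zero _).1 hx)
    replace h : y + Φ.d w = Φ.d z := h
    have hdz : Φ.d ((z : T) - w) = y := by rw [map_sub, ← h, add_sub_cancel_right]
    have hw' : w ∈ Φ.F (p + 1) n := F_mono hw (by lia) (by lia)
    refine ⟨⟨z - w, Φ.mem_Z.2 ⟨sub_mem z.2.1 (F_mono hw' (by lia) rfl), ?_⟩⟩, ?_⟩
    · rw [hdz]; exact F_mono hy (by lia) rfl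
    · refine (Φ.cls_eq_cls _ _).2 (Φ.mem_D.2 ⟨-w, 0, neg_mem hw', ?_, zero_mem _, ?_, ?_⟩)
      · rw [map_neg]; exact neg_mem hdw
      · rw [map_zero]; exact zero_mem _
      · simp

/-- The relations of E_{r+1} allow w one filtration step lower than those of E_r. This extra step is
exactly the source of d_r, so it accounts for the boundaries. -/
lemma nextCycles_mem_range_iff (r : ℤ) {p n p' n' : ℤ} (hp : p' + r = p) (hn : n' + 1 = n)
    (z : Φ.Z (r + 1) p n) :
    Φ.nextCycles r p n z ∈ LinearMap.range (Φ.pageD r hp hn) ↔ Φ.cls (r + 1) p n z = 0 := by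
  subst hp hn
  rw [cls_eq_zero, mem_D]
  constructor
  · rintro ⟨x, hx⟩
    obtain ⟨a, rfl⟩ := Φ.cls_surjective _ _ _ x
    obtain ⟨y, w, hy, hdy, hw, hdw, h⟩ := Φ.mem_D.1 ((Φ.cls_eq_cls _ _).1 hx.symm)
    replace h : y + Φ.d w = z - Φ.d a := h
    refine ⟨y, w + a, hy, ?_, ?_, ?_, ?_⟩
    · have : y = z - Φ.d a - Φ.d w := by rw [← h, add_sub_cancel_right]
      rw [this, map_sub, map_sub, Φ.d_d, Φ.d_d, sub_zero, sub_zero]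
      exact z.2.2
    · exact add_mem (F_mono hw (by lia) rfl) (F_mono a.2.1 (by lia) (by lia))
    · rw [map_add]; exact add_mem hdw a.2.2
    · rw [map_add, ← add_assoc, h, sub_add_cancel]
  · rintro ⟨y, w, hy, hdy, hw, hdw, h⟩
    refine ⟨Φ.cls _ _ _ ⟨w, F_mono hw (by lia) (by lia), hdw⟩, ?_⟩
    refine ((Φ.cls_eq_cls _ _).2 (Φ.mem_D.2 ⟨y, 0, hy, F_mono hdy (by lia) rfl, zero_mem _, ?_,
      ?_⟩)).symm
    · rw [map_zero]; exact zero_mem _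
    · rw [map_zero, add_zero]
      change y = z - Φ.d w
      rw [← h, add_sub_cancel_right]

/-! ### The spectral sequence -/

variable {κ : Type} [AddGroup κ]

/-- A system of positions: on the `r`-th page the differential moves by `v r`, which raises the
filtration degree by `r` and the total degree by one. -/
structure Positions (κ : Type) [AddGroup κ] where
  v : ℤ → κ
  fil : κ → ℤ
  deg : κ → ℤ
  fil_add : ∀ x r, fil (x + v r) = fil x + r
  deg_add : ∀ x r, deg (x + v r) = deg x + 1

variable (P : Positions κ)

/-- The `r`-th page of the spectral sequence of a filtered differential module. -/
def page (r : ℤ) : HomologicalComplex (ModuleCat.{v} k) (ComplexShape.up' (P.v r)) where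
  X x := ModuleCat.of k (Φ.PageX r (P.fil x) (P.deg x))
  d x y := open Classical in if h : x + P.v r = y then
    ModuleCat.ofHom (Φ.pageD r (by rw [← h, P.fil_add]) (by rw [← h, P.deg_add])) else 0
  shape x y h := dif_neg h
  d_comp_d' x y z h h' := by
    rw [dif_pos (show x + P.v r = y from h), dif_pos (show y + P.v r = z from h')]
    exact ModuleCat.hom_ext (LinearMap.ext fun a => Φ.pageD_pageD r
      (by rw [← show x + P.v r = y from h, P.fil_add])
      (by rw [← show x + P.v r = y from h, P.deg_add])
      (by rw [← show y + P.v r = z from h', P.fil_add])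
      (by rw [← show y + P.v r = z from h', P.deg_add]) a)

lemma page_d {r : ℤ} {x y : κ} (h : x + P.v r = y) : (Φ.page P r).d x y =
    ModuleCat.ofHom (Φ.pageD r (by rw [← h, P.fil_add]) (by rw [← h, P.deg_add])) :=
  dif_pos h

lemma range_nextCycles_eq_ker_page_d (r : ℤ) (x : κ) :
    LinearMap.range (Φ.nextCycles r (P.fil x) (P.deg x)) =
      LinearMap.ker ((Φ.page P r).d x ((ComplexShape.up' (P.v r)).next x)).hom := by
  have hn : x + P.v r = (ComplexShape.up' (P.v r)).next x :=
    ((ComplexShape.up' (P.v r)).next_eq' (show (ComplexShape.up' (P.v r)).Rel x _ from rfl)).symm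
  rw [Φ.page_d P hn]
  exact Φ.range_nextCycles r (by rw [← hn, P.fil_add]) (by rw [← hn, P.deg_add])

/-- The isomorphism is pinned down on representatives: the class of z goes to the class of the same
z. Tracing survival through the pages depends on this. -/
lemma exists_pageIso (r r' : ℤ) (x : κ) (hr : r + 1 = r') :
    ∃ e : (Φ.page P r).homology x ≅ (Φ.page P r').X x,
      ∀ (z : T) (hz : z ∈ Φ.Z r (P.fil x) (P.deg x)) (hz' : z ∈ Φ.Z r' (P.fil x) (P.deg x))
        (c : (Φ.page P r).cycles x), (Φ.page P r).iCycles x c = Φ.cls r _ _ ⟨z, hz⟩ →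
        e.hom ((Φ.page P r).homologyπ x c) = Φ.cls r' _ _ ⟨z, hz'⟩ := by
  subst hr
  have hp : (ComplexShape.up' (P.v r)).prev x + P.v r = x := by
    rw [(ComplexShape.up' (P.v r)).prev_eq'
      (show (ComplexShape.up' (P.v r)).Rel (x - P.v r) x from sub_add_cancel _ _), sub_add_cancel]
  obtain ⟨e, he⟩ := ShortComplex.moduleCat_exists_homologyIso ((Φ.page P r).sc x)
    ((Φ.page P (r + 1)).X x) (Φ.nextCycles r (P.fil x) (P.deg x)) (Φ.cls (r + 1) _ _)
    (Φ.cls_surjective _ _ _)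
    (Φ.range_nextCycles_eq_ker_page_d P r x)
    (by
      intro z
      change _ ∈ LinearMap.range ((Φ.page P r).d _ x).hom ↔ _
      rw [Φ.page_d P hp]
      exact Φ.nextCycles_mem_range_iff r (by rw [← P.fil_add, hp]) (by rw [← P.deg_add _ r, hp]) z)
  exact ⟨e, fun z hz hz' c hc => he ⟨z, hz'⟩ c hc⟩

/-- The spectral sequence of a filtered differential module. -/
def spectralSequence (r₀ : ℤ) :
    SpectralSequence (ModuleCat.{v} k) (fun r => ComplexShape.up' (P.v r)) r₀ where
  page r _ := Φ.page P r
  iso r r' x h _ := (Φ.exists_pageIso P r r' x h).choose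

end FilteredDifferential

/-- If `g` maps `A` onto the permanent cycles and the preimage of the eventual boundaries is the
kernel of a surjection `h : A → N`, then `N` is the limit term. -/
lemma SpecSeq.nonempty_eInfty_equiv {k : Type u} [Field k] {κ : Type} {c : ℤ → ComplexShape κ}
    {r₀ : ℤ} (E : SpectralSequence (ModuleCat.{v} k) c r₀) (x : κ) {A N : Type v}
    [AddCommGroup A] [Module k A] [AddCommGroup N] [Module k N]
    (g : A →ₗ[k] (E.page r₀ le_rfl).X x) (hg : LinearMap.range g = permanentCycles E x)
    (h : A →ₗ[k] N) (hh : Function.Surjective h)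
    (hgh : ∀ a, g a ∈ eventualBoundaries E x ↔ h a = 0) : Nonempty (EInfty E x ≃ₗ[k] N) := by
  let f : A →ₗ[k] EInfty E x := Submodule.mkQ _ ∘ₗ
    g.codRestrict (permanentCycles E x) fun a => hg ▸ LinearMap.mem_range_self g a
  have hf : Function.Surjective f := by
    refine (Submodule.mkQ_surjective _).comp fun ⟨e, he⟩ => ?_
    rw [← hg] at he
    obtain ⟨a, ha⟩ := he
    exact ⟨a, Subtype.ext ha⟩
  have hk : LinearMap.ker f = LinearMap.ker h := by
    ext a
    rw [LinearMap.mem_ker, LinearMap.mem_ker, ← hgh]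
    exact Submodule.Quotient.mk_eq_zero _
  exact ⟨(f.quotKerEquivOfSurjective hf).symm ≪≫ₗ Submodule.quotEquivOfEq _ _ hk ≪≫ₗ
    h.quotKerEquivOfSurjective hh⟩

namespace FilteredDifferential

variable {k : Type u} [Field k] {T : Type v} [AddCommGroup T] [Module k T]
  (Φ : FilteredDifferential k T) {κ : Type} [AddGroup κ] (P : Positions κ)

/-! ### The limit page -/

/-- The subspace of the `r`-th page that consists of the classes of elements of `S`. -/
def classes (r p n : ℤ) (S : Submodule k T) : Submodule k (Φ.PageX r p n) :=
  (S.comap (Φ.Z r p n).subtype).map (Φ.cls r p n)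

lemma mem_classes {r p n : ℤ} {S : Submodule k T} {x : Φ.PageX r p n} :
    x ∈ Φ.classes r p n S ↔ ∃ z ∈ S, ∃ hz : z ∈ Φ.Z r p n, Φ.cls r p n ⟨z, hz⟩ = x :=
  ⟨fun ⟨z, hz, h⟩ => ⟨z, hz, z.2, h⟩, fun ⟨z, hz, hz', h⟩ => ⟨⟨z, hz'⟩, hz, h⟩⟩

/-- Since D ≤ Z, a representative s congruent to z modulo D lies in Z automatically. -/
lemma cls_mem_classes {r p n : ℤ} {S : Submodule k T} {z : T} (hz : z ∈ Φ.Z r p n) :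
    Φ.cls r p n ⟨z, hz⟩ ∈ Φ.classes r p n S ↔ ∃ s ∈ S, z - s ∈ Φ.D r p n := by
  rw [mem_classes]
  constructor
  · rintro ⟨s, hs, hs', h⟩
    exact ⟨s, hs, (Φ.cls_eq_cls _ _).1 h.symm⟩
  · rintro ⟨s, hs, h⟩
    refine ⟨s, hs, ?_, ((Φ.cls_eq_cls ⟨z, hz⟩ ⟨s, ?_⟩).2 h).symm⟩ <;>
    · have := sub_mem hz (Φ.D_le_Z r p n h)
      rwa [sub_sub_cancel] at this

lemma iso_homologyπ {r₀ : ℤ} (r : ℤ) (hr : r₀ ≤ r) (x : κ) {z : T}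
    (hz : z ∈ Φ.Z r (P.fil x) (P.deg x)) (hz' : z ∈ Φ.Z (r + 1) (P.fil x) (P.deg x))
    (c : (Φ.page P r).cycles x) (hc : (Φ.page P r).iCycles x c = Φ.cls r _ _ ⟨z, hz⟩) :
    ((Φ.spectralSequence P r₀).iso r (r + 1) x rfl hr).hom ((Φ.page P r).homologyπ x c) =
      Φ.cls (r + 1) _ _ ⟨z, hz'⟩ :=
  (Φ.exists_pageIso P r (r + 1) x rfl).choose_spec z hz hz' c hc

lemma page_d_cls {r : ℤ} {x y : κ} (h : x + P.v r = y) (z : Φ.Z r (P.fil x) (P.deg x)) :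
    (Φ.page P r).d x y (Φ.cls r _ _ z) = Φ.cls r (P.fil y) (P.deg y)
      ⟨Φ.d z, Φ.d_mem_Z (by rw [← h, P.fil_add]) (by rw [← h, P.deg_add]) z.2⟩ := by
  rw [Φ.page_d P h]
  rfl

lemma exists_iCycles_eq_cls {r : ℤ} (x : κ) {z : T}
    (hz : z ∈ Φ.Z r (P.fil x) (P.deg x)) (hz' : z ∈ Φ.Z (r + 1) (P.fil x) (P.deg x)) :
    ∃ c : (Φ.page P r).cycles x, (Φ.page P r).iCycles x c = Φ.cls r _ _ ⟨z, hz⟩ := by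
  refine ((Φ.page P r).sc x).moduleCat_exists_iCycles_eq _ ?_
  have := LinearMap.mem_range_self (Φ.nextCycles r _ _) ⟨z, hz'⟩
  rw [Φ.range_nextCycles_eq_ker_page_d P r x] at this
  exact this

lemma exists_cls_eq_iCycles {r : ℤ} (x : κ) (c : (Φ.page P r).cycles x) :
    ∃ (z : T) (hz : z ∈ Φ.Z r (P.fil x) (P.deg x)), z ∈ Φ.Z (r + 1) (P.fil x) (P.deg x) ∧
      (Φ.page P r).iCycles x c = Φ.cls r _ _ ⟨z, hz⟩ := by
  have h' : (Φ.page P r).iCycles x c ∈ LinearMap.range (Φ.nextCycles r (P.fil x) (P.deg x)) := by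
    rw [Φ.range_nextCycles_eq_ker_page_d P r x]
    exact ((Φ.page P r).sc x).moduleCat_g_iCycles c
  obtain ⟨z, hz⟩ := h'
  exact ⟨z, _, z.2, hz.symm⟩

lemma B_le_Z (r s p n : ℤ) : Φ.B r p n ≤ Φ.Z s p n := by
  rintro _ ⟨h, w, -, rfl⟩
  refine Φ.mem_Z.2 ⟨h, ?_⟩
  rw [Φ.d_d]; exact zero_mem _

lemma B_mono (p n : ℤ) : Monotone fun r => Φ.B r p n := by
  rintro r s hrs _ ⟨h, w, hw, rfl⟩
  exact ⟨h, w, F_mono hw (by lia) rfl, rfl⟩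

/-- Passing back from E_{r+1} to E_r shrinks the relations. A relation y + dw of E_{r+1} splits into
y, still a relation of E_r, and dw ∈ B_{r+1}, which `hB` absorbs into S. Hence the description by S
persists through all pages. -/
lemma pullback_classes {r₀ : ℤ} (r : ℤ) (hr : r₀ ≤ r) (x : κ) (S : Submodule k T)
    (hB : Φ.B (r + 1) (P.fil x) (P.deg x) ≤ S) (hZ : S ≤ Φ.Z (r + 1) (P.fil x) (P.deg x)) :
    SpecSeq.pullback (Φ.spectralSequence P r₀) x r hr (Φ.classes (r + 1) _ _ S) =
      Φ.classes r _ _ S := by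
  have key (c : (Φ.page P r).cycles x) (z : T) (hz : z ∈ Φ.Z r (P.fil x) (P.deg x))
      (hz' : z ∈ Φ.Z (r + 1) (P.fil x) (P.deg x))
      (hc : (Φ.page P r).iCycles x c = Φ.cls r _ _ ⟨z, hz⟩) :
      ((Φ.spectralSequence P r₀).iso r (r + 1) x rfl hr).hom ((Φ.page P r).homologyπ x c) ∈
        Φ.classes (r + 1) _ _ S ↔ ∃ s ∈ S, z - s ∈ Φ.D (r + 1) (P.fil x) (P.deg x) := by
    rw [Φ.iso_homologyπ P r hr x hz hz' c hc]
    exact Φ.cls_mem_classes hz'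
  ext e
  constructor
  · rintro ⟨c, hc, rfl⟩
    obtain ⟨z, hz, hz', h⟩ := Φ.exists_cls_eq_iCycles P x c
    obtain ⟨s, hs, hzs⟩ := (key c z hz hz' h).1 hc
    obtain ⟨y, w, hy, hdy, hw, hdw, hyw⟩ := Φ.mem_D.1 hzs
    refine (congrArg (· ∈ Φ.classes r _ _ S) h).mpr ((Φ.cls_mem_classes hz).2
      ⟨s + Φ.d w, add_mem hs (hB ⟨hdw, w, hw, rfl⟩),
        Φ.mem_D.2 ⟨y, 0, hy, F_mono hdy (by lia) rfl, zero_mem _, ?_, ?_⟩⟩)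
    · rw [map_zero]; exact zero_mem _
    · rw [map_zero, add_zero, ← sub_sub, ← hyw, add_sub_cancel_right]
  · intro he
    obtain ⟨z, hzS, hz, rfl⟩ := Φ.mem_classes.1 he
    obtain ⟨c, hc⟩ := Φ.exists_iCycles_eq_cls P x hz (hZ hzS)
    refine ⟨c, (key c z hz (hZ hzS) hc).2 ⟨z, hzS, ?_⟩, hc⟩
    rw [sub_self]; exact zero_mem _

lemma surviving_eq {r₀ : ℤ} (x : κ) (n : ℕ) (r : ℤ) (hr : r₀ ≤ r) :
    SpecSeq.surviving (Φ.spectralSequence P r₀) x n r hr =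
      Φ.classes r _ _ (Φ.Z (r + n) (P.fil x) (P.deg x)) := by
  induction n generalizing r with
  | zero =>
    refine (eq_top_iff.2 fun e _ => ?_).symm
    obtain ⟨z, rfl⟩ := Φ.cls_surjective _ _ _ e
    exact Φ.mem_classes.2 ⟨z, by simp, z.2, rfl⟩
  | succ n ih =>
    rw [SpecSeq.surviving, ih, Φ.pullback_classes P r hr x _ (Φ.B_le_Z _ _ _ _)
      (Φ.Z_anti (by lia) _ _)]
    congr 2
    push_cast
    ring

lemma dying_eq {r₀ : ℤ} (x : κ) (n : ℕ) (r : ℤ) (hr : r₀ ≤ r) :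
    SpecSeq.dying (Φ.spectralSequence P r₀) x n r hr =
      Φ.classes r _ _ (Φ.B (r + n) (P.fil x) (P.deg x)) := by
  induction n generalizing r with
  | zero =>
    -- An element of B_r is a relation of E_r with y = 0, so its class is already zero.
    refine (eq_bot_iff.2 fun e he => ?_).symm
    obtain ⟨_, ⟨hF, w, hw, rfl⟩, hz, rfl⟩ := Φ.mem_classes.1 he
    refine (Φ.cls_eq_zero _).2 (Φ.mem_D.2 ⟨0, w, zero_mem _, ?_, by simpa using hw, hF,
      zero_add _⟩)
    rw [map_zero]; exact zero_mem _
  | succ n ih =>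
    rw [SpecSeq.dying, ih, Φ.pullback_classes P r hr x _ (Φ.B_mono _ _ (by lia))
      (Φ.B_le_Z _ _ _ _)]
    congr 2
    push_cast
    ring

/-- Once the filtration has reached zero in the next degree, a sufficiently late Z_r consists of
genuine cocycles. -/
lemma permanentCycles_eq {r₀ : ℤ} (x : κ) (p : ℤ) (hp : Φ.F p (P.deg x + 1) = ⊥) :
    SpecSeq.permanentCycles (Φ.spectralSequence P r₀) x =
      Φ.classes r₀ _ _ (Φ.F (P.fil x) (P.deg x) ⊓ LinearMap.ker Φ.d) := by
  simp only [SpecSeq.permanentCycles, surviving_eq]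
  apply le_antisymm
  -- This number of pages makes the filtration of dz at least p.
  · refine (iInf_le _ (p - P.fil x - r₀).toNat).trans (Submodule.map_mono
      (Submodule.comap_mono fun z hz => ⟨hz.1, ?_⟩))
    have : Φ.d z ∈ Φ.F p (P.deg x + 1) := F_mono hz.2 (by lia) rfl
    rwa [hp] at this
  · refine le_iInf fun n => Submodule.map_mono (Submodule.comap_mono (Φ.ker_d_le_Z _ _ _))

lemma cls_mem_eventualBoundaries_iff {r₀ : ℤ} (x : κ) {z : T}
    (hz : z ∈ Φ.Z r₀ (P.fil x) (P.deg x)) (hdz : Φ.d z = 0) (hF : z ∈ Φ.F (P.fil x) (P.deg x)) :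
    Φ.cls r₀ _ _ ⟨z, hz⟩ ∈ SpecSeq.eventualBoundaries (Φ.spectralSequence P r₀) x ↔
      ∃ y ∈ Φ.F (P.fil x + 1) (P.deg x), Φ.d y = 0 ∧
        ∃ q, ∃ w ∈ Φ.F q (P.deg x - 1), y + Φ.d w = z := by
  simp only [SpecSeq.eventualBoundaries, dying_eq]
  -- The B_r increase with r, so membership in their supremum is membership in one of them.
  refine (Submodule.mem_iSup_of_directed _ (Monotone.directed_le fun m n h =>
    Submodule.map_mono (Submodule.comap_mono (Φ.B_mono _ _ (by lia))))).trans ?_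
  refine (exists_congr fun n => Φ.cls_mem_classes hz).trans ?_
  constructor
  · rintro ⟨n, _, ⟨-, w', hw', rfl⟩, h⟩
    obtain ⟨y, w, hy, -, hw, -, h⟩ := Φ.mem_D.1 h
    have h' : y + Φ.d (w + w') = z := by rw [map_add, ← add_assoc, h, sub_add_cancel]
    refine ⟨y, hy, ?_, P.fil x - (r₀ + n) + 1, w + w', add_mem (F_mono hw (by lia) rfl) hw', h'⟩
    rw [← h', map_add, Φ.d_d, add_zero] at hdz
    exact hdz
  · rintro ⟨y, hy, hdy, q, w, hw, rfl⟩
    -- Late enough that B at that page admits boundaries of elements of filtration q.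
    refine ⟨(P.fil x - r₀ + 1 - q).toNat, Φ.d w, ⟨?_, w, F_mono hw (by lia) rfl, rfl⟩,
      Φ.mem_D.2 ⟨y, 0, hy, ?_, zero_mem _, ?_, ?_⟩⟩
    · have := sub_mem hF (F_mono hy (by lia) rfl)
      rwa [add_sub_cancel_left] at this
    · rw [hdy]; exact zero_mem _
    · rw [map_zero]; exact zero_mem _
    · rw [map_zero, add_zero, add_sub_cancel_right]

/-! ### Convergence -/

/-- The filtration of the cohomology of `K` induced by subspaces `G p n` of `K.X n`. -/
def _root_.CochainComplex.cohomologyFiltration (K : CochainComplex (ModuleCat.{v} k) ℤ)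
    (G : ∀ _ n : ℤ, Submodule k (K.X n)) (p n : ℤ) : Submodule k (K.homology n) :=
  ((G p n).comap (K.iCycles n).hom).map (K.homologyπ n).hom

/-- A realization of `Φ` by a cochain complex `K` with a filtration `G`. -/
structure Realization (K : CochainComplex (ModuleCat.{v} k) ℤ)
    (G : ∀ _ n : ℤ, Submodule k (K.X n)) where
  ι : ∀ n, K.X n →ₗ[k] T
  injective : ∀ n, Function.Injective (ι n)
  d_ι : ∀ n n', n + 1 = n' → ∀ t, Φ.d (ι n t) = ι n' (K.d n n' t)
  F_eq : ∀ p n, Φ.F p n = (G p n).map (ι n)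

variable {Φ}

namespace Realization

variable {K : CochainComplex (ModuleCat.{v} k) ℤ} {G : ∀ _ n : ℤ, Submodule k (K.X n)}
  (ρ : Φ.Realization K G)

lemma ι_mem_F_iff {p n : ℤ} (t : K.X n) : ρ.ι n t ∈ Φ.F p n ↔ t ∈ G p n := by
  rw [ρ.F_eq]
  exact (ρ.injective n).mem_set_image

lemma F_eq_bot (ρ : Φ.Realization K G) {p n : ℤ} (h : G p n = ⊥) : Φ.F p n = ⊥ := by
  rw [ρ.F_eq, h, Submodule.map_bot]

lemma G_le (ρ : Φ.Realization K G) (p n : ℤ) : G (p + 1) n ≤ G p n := fun t ht =>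
  (ρ.ι_mem_F_iff t).1 (Φ.F_succ_le p n ((ρ.ι_mem_F_iff t).2 ht))

lemma d_iCycles (n : ℤ) (c : K.cycles n) : Φ.d (ρ.ι n (K.iCycles n c)) = 0 := by
  rw [ρ.d_ι n (n + 1) rfl, ← ConcreteCategory.comp_apply, K.iCycles_d]
  exact map_zero _

lemma homologyπ_eq_iff (n : ℤ) (c c' : K.cycles n) :
    K.homologyπ n c = K.homologyπ n c' ↔
      ∃ w : K.X (n - 1), ρ.ι n (K.iCycles n c) - ρ.ι n (K.iCycles n c') =
        Φ.d (ρ.ι (n - 1) w) := by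
  refine ((K.sc n).moduleCat_homologyπ_eq_iff c c').trans ?_
  have hp : (ComplexShape.up ℤ).prev n = n - 1 := CochainComplex.prev ℤ n
  change (∃ w, K.d ((ComplexShape.up ℤ).prev n) n w = K.iCycles n c - K.iCycles n c') ↔ _
  rw [hp]
  refine exists_congr fun w => ?_
  rw [ρ.d_ι (n - 1) n (sub_add_cancel _ _), ← map_sub (ρ.ι n), (ρ.injective n).eq_iff, eq_comm]

/-- The cycles in filtration degree `p`. -/
abbrev filteredCycles (_ : Φ.Realization K G) (p n : ℤ) : Submodule k (K.cycles n) :=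
  (G p n).comap (K.iCycles n).hom

/-- The projection from the cycles in filtration degree `p` to the associated graded space of the
cohomology. -/
def toGr (p n : ℤ) : ρ.filteredCycles p n →ₗ[k]
    SpecSeq.gr (H := fun n => K.homology n) (K.cohomologyFiltration G) p n :=
  Submodule.mkQ _ ∘ₗ (K.homologyπ n).hom.submoduleMap (ρ.filteredCycles p n)

lemma toGr_surjective (p n : ℤ) : Function.Surjective (ρ.toGr p n) :=
  (Submodule.mkQ_surjective _).comp (LinearMap.submoduleMap_surjective _ _)

/-- The right-hand side is the condition describing B_∞. Exhaustiveness `hex` supplies the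
filtration degree q of the bounding cochain. -/
lemma toGr_eq_zero_iff (hex : ∀ n t, ∃ p, t ∈ G p n) (p n : ℤ) (c : ρ.filteredCycles p n) :
    ρ.toGr p n c = 0 ↔ ∃ y ∈ Φ.F (p + 1) n, Φ.d y = 0 ∧
        ∃ q, ∃ w ∈ Φ.F q (n - 1), y + Φ.d w = ρ.ι n (K.iCycles n c.1) := by
  have h : ρ.toGr p n c = 0 ↔ K.homologyπ n c.1 ∈ K.cohomologyFiltration G (p + 1) n :=
    Submodule.Quotient.mk_eq_zero _
  rw [h]
  constructor
  · rintro ⟨c', hc', h⟩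
    obtain ⟨w, hw⟩ := (ρ.homologyπ_eq_iff n c.1 c').1 h.symm
    obtain ⟨q, hq⟩ := hex _ w
    refine ⟨_, (ρ.ι_mem_F_iff _).2 hc', ρ.d_iCycles n c', q, _, (ρ.ι_mem_F_iff _).2 hq, ?_⟩
    rw [← hw, add_sub_cancel]
  · rintro ⟨y, hy, hdy, q, w, hw, h⟩
    rw [ρ.F_eq] at hy hw
    obtain ⟨y, hy, rfl⟩ := hy
    obtain ⟨w, hw, rfl⟩ := hw
    rw [ρ.d_ι n (n + 1) rfl, ← map_zero (ρ.ι (n + 1))] at hdy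
    obtain ⟨c', hc'⟩ := (K.sc n).moduleCat_exists_iCycles_eq y (by
      change K.d n _ y = 0
      rw [CochainComplex.next ℤ n]
      exact ρ.injective _ hdy)
    replace hc' : K.iCycles n c' = y := hc'
    refine ⟨c', ?_, ((ρ.homologyπ_eq_iff n c.1 c').2 ⟨w, ?_⟩).symm⟩
    · change K.iCycles n c' ∈ G (p + 1) n
      rwa [hc']
    · rw [← h, hc', add_sub_cancel_left]

lemma cycle_mem (x : κ) (c : ρ.filteredCycles (P.fil x) (P.deg x)) :
    ρ.ι _ (K.iCycles _ c.1) ∈ Φ.F (P.fil x) (P.deg x) ⊓ LinearMap.ker Φ.d :=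
  ⟨(ρ.ι_mem_F_iff _).2 c.2, ρ.d_iCycles _ _⟩

/-- The class of a cycle in the page `r₀`. -/
def toPage (r₀ : ℤ) (x : κ) :
    ρ.filteredCycles (P.fil x) (P.deg x) →ₗ[k] Φ.PageX r₀ (P.fil x) (P.deg x) :=
  Φ.cls r₀ _ _ ∘ₗ (ρ.ι _ ∘ₗ (K.iCycles _).hom ∘ₗ Submodule.subtype _).codRestrict _
    fun c => Φ.ker_d_le_Z r₀ _ _ (ρ.cycle_mem P x c)

lemma range_toPage (r₀ : ℤ) (x : κ) (hterm : ∀ n, ∃ p, G p n = ⊥) :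
    LinearMap.range (ρ.toPage P r₀ x) =
      SpecSeq.permanentCycles (Φ.spectralSequence P r₀) x := by
  obtain ⟨p, hp⟩ := hterm (P.deg x + 1)
  rw [Φ.permanentCycles_eq P x p (ρ.F_eq_bot hp)]
  ext e
  constructor
  · rintro ⟨c, rfl⟩
    exact Φ.mem_classes.2 ⟨_, ρ.cycle_mem P x c, _, rfl⟩
  · intro he
    obtain ⟨z, ⟨hz, hdz⟩, hz', rfl⟩ := Φ.mem_classes.1 he
    rw [SetLike.mem_coe, ρ.F_eq] at hz
    obtain ⟨t, ht, rfl⟩ := hz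
    rw [SetLike.mem_coe, LinearMap.mem_ker, ρ.d_ι _ _ rfl, ← map_zero (ρ.ι _)] at hdz
    obtain ⟨c, hc⟩ := (K.sc (P.deg x)).moduleCat_exists_iCycles_eq t (by
      change K.d _ _ t = 0
      rw [CochainComplex.next ℤ _]
      exact ρ.injective _ hdz)
    replace hc : K.iCycles _ c = t := hc
    refine ⟨⟨c, ?_⟩, ?_⟩
    · change K.iCycles _ c ∈ G (P.fil x) (P.deg x)
      rwa [hc]
    · exact congrArg (Φ.cls r₀ _ _) (Subtype.ext (congrArg (ρ.ι _) hc))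

theorem convergesTo (ρ : Φ.Realization K G) (r₀ : ℤ) (hex : ∀ n t, ∃ p, t ∈ G p n)
    (hterm : ∀ n, ∃ p, G p n = ⊥) :
    SpecSeq.ConvergesTo (Φ.spectralSequence P r₀) P.fil P.deg (fun n => K.homology n)
      (K.cohomologyFiltration G) where
  regular x := by
    obtain ⟨p, hp⟩ := hterm (P.deg x + 1)
    refine ⟨p - P.fil x, fun r hr hR y => ?_⟩
    by_cases h : x + P.v r = y
    · refine ModuleCat.hom_ext (LinearMap.ext fun e => ?_)
      obtain ⟨z, rfl⟩ := Φ.cls_surjective _ _ _ e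
      refine (Φ.page_d_cls P h z).trans ((Φ.cls_eq_zero _).2 ?_)
      have : Φ.d z ∈ Φ.F p (P.deg x + 1) := F_mono z.2.2 (by lia) rfl
      rw [ρ.F_eq_bot hp] at this
      change Φ.d z ∈ Φ.D r (P.fil y) (P.deg y)
      rw [show Φ.d z = 0 from this]
      exact zero_mem _
    · exact (Φ.page P r).shape x y h
  decreasing p n := Submodule.map_mono (Submodule.comap_mono (ρ.G_le p n))
  exhaustive n := by
    refine eq_top_iff.2 fun y _ => ?_
    obtain ⟨c, rfl⟩ := (K.sc n).moduleCat_homologyπ_surjective y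
    obtain ⟨p, hp⟩ := hex n (K.iCycles n c)
    exact Submodule.mem_iSup_of_mem p ⟨c, hp, rfl⟩
  terminates n := by
    obtain ⟨p, hp⟩ := hterm n
    refine ⟨p, eq_bot_iff.2 ?_⟩
    rintro _ ⟨c, hc, rfl⟩
    rw [hp] at hc
    have : c = 0 := (K.sc n).moduleCat_iCycles_injective (Eq.trans hc (map_zero _).symm)
    rw [this]
    exact map_zero _
  limit x := by
    refine SpecSeq.nonempty_eInfty_equiv (Φ.spectralSequence P r₀) x (ρ.toPage P r₀ x)
      (ρ.range_toPage P r₀ x hterm) (ρ.toGr _ _) (ρ.toGr_surjective _ _) fun c => ?_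
    rw [ρ.toGr_eq_zero_iff hex]
    exact Φ.cls_mem_eventualBoundaries_iff P x _ (ρ.cycle_mem P x c).2 (ρ.cycle_mem P x c).1

end Realization

end FilteredDifferential

namespace FilteredDifferential

variable {k : Type u} [Field k] {T : Type v} [AddCommGroup T] [Module k T]
  (Φ : FilteredDifferential k T)

/-! ### The first page -/

/-- Coordinates that identify the part of `gr^p` in degrees `n - 1`, `n`, `n + 1` with a short
complex `S`. -/
structure GradedChart (S : ShortComplex (ModuleCat.{v} k)) (p n : ℤ) where
  π₁ : T →ₗ[k] S.X₁
  π₂ : T →ₗ[k] S.X₂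
  π₃ : T →ₗ[k] S.X₃
  exists_π₁ : ∀ m, ∃ a ∈ Φ.F p (n - 1), π₁ a = m
  exists_π₂ : ∀ m, ∃ a ∈ Φ.F p n, π₂ a = m
  π₂_eq_zero_iff : ∀ a ∈ Φ.F p n, π₂ a = 0 ↔ a ∈ Φ.F (p + 1) n
  π₃_eq_zero_iff : ∀ a ∈ Φ.F p (n + 1), π₃ a = 0 ↔ a ∈ Φ.F (p + 1) (n + 1)
  π₂_d : ∀ a ∈ Φ.F p (n - 1), π₂ (Φ.d a) = S.f (π₁ a)
  π₃_d : ∀ a ∈ Φ.F p n, π₃ (Φ.d a) = S.g (π₂ a)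

variable {Φ}

/-- Modulo F^{p+1} the chart turns d into the maps of S. So Z_1 maps onto the cycles, and D_1 =
F^{p+1} + dF^p is the preimage of the boundaries. -/
lemma GradedChart.exists_iso {S : ShortComplex (ModuleCat.{v} k)} {p n : ℤ}
    (χ : Φ.GradedChart S p n) :
    ∃ e : ModuleCat.of k (Φ.PageX 1 p n) ≅ S.homology, ∀ z : Φ.Z 1 p n,
      ∃ c : S.cycles, S.iCycles c = χ.π₂ z ∧ e.hom (Φ.cls 1 p n z) = S.homologyπ c := by
  have hg (z : Φ.Z 1 p n) : S.g (χ.π₂ z) = 0 := by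
    rw [← χ.π₃_d _ z.2.1]
    exact (χ.π₃_eq_zero_iff _ (Φ.d_mem _ _ _ z.2.1)).2 z.2.2
  obtain ⟨e, he⟩ := S.moduleCat_exists_homologyIso (ModuleCat.of k (Φ.PageX 1 p n))
    (χ.π₂ ∘ₗ (Φ.Z 1 p n).subtype) (Φ.cls 1 p n) (Φ.cls_surjective 1 p n)
    (by
      apply le_antisymm
      · rintro _ ⟨z, rfl⟩
        exact hg z
      · intro m hm
        obtain ⟨a, ha, rfl⟩ := χ.exists_π₂ m
        refine ⟨⟨a, ha, (χ.π₃_eq_zero_iff _ (Φ.d_mem _ _ _ ha)).1 ?_⟩, rfl⟩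
        rw [χ.π₃_d _ ha]
        exact hm)
    (by
      intro z
      rw [cls_eq_zero, mem_D]
      constructor
      · rintro ⟨m, hm⟩
        obtain ⟨a, ha, rfl⟩ := χ.exists_π₁ m
        have hda : Φ.d a ∈ Φ.F p n := F_mono (Φ.d_mem _ _ _ ha) le_rfl (by lia)
        have hza : (z : T) - Φ.d a ∈ Φ.F (p + 1) n := by
          refine (χ.π₂_eq_zero_iff _ (sub_mem z.2.1 hda)).1 ?_
          rw [map_sub, χ.π₂_d a ha, sub_eq_zero]
          exact hm.symm
        exact ⟨z - Φ.d a, a, hza, Φ.d_mem _ _ _ hza, F_mono ha (by lia) rfl, hda,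
          sub_add_cancel _ _⟩
      · rintro ⟨y, w, hy, -, hw, -, h⟩
        have hw' : w ∈ Φ.F p (n - 1) := F_mono hw (by lia) rfl
        refine ⟨χ.π₁ w, ?_⟩
        change S.f (χ.π₁ w) = χ.π₂ z
        rw [← χ.π₂_d w hw', ← h, map_add,
          (χ.π₂_eq_zero_iff y (F_mono hy (by lia) rfl)).2 hy, zero_add])
  refine ⟨e.symm, fun z => ?_⟩
  obtain ⟨c, hc⟩ := S.moduleCat_exists_iCycles_eq _ (hg z)
  refine ⟨c, hc, ?_⟩
  rw [← he z c hc]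
  exact congrArg (fun f => f.hom (S.homologyπ c)) e.hom_inv_id

/-- The identification of the first page with the homology of `S`. -/
def GradedChart.iso {S : ShortComplex (ModuleCat.{v} k)} {p n : ℤ} (χ : Φ.GradedChart S p n) :
    ModuleCat.of k (Φ.PageX 1 p n) ≅ S.homology :=
  χ.exists_iso.choose

lemma GradedChart.iso_cls {S : ShortComplex (ModuleCat.{v} k)} {p n : ℤ}
    (χ : Φ.GradedChart S p n) (z : Φ.Z 1 p n) :
    ∃ c : S.cycles, S.iCycles c = χ.π₂ z ∧ χ.iso.hom (Φ.cls 1 p n z) = S.homologyπ c :=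
  χ.exists_iso.choose_spec z

/-- The map φ need only match d up to boundaries of S', because the target is homology. -/
lemma GradedChart.page_d_iso {κ : Type} [AddGroup κ] (P : Positions κ)
    {S S' : ShortComplex (ModuleCat.{v} k)} {x y : κ} (h : x + P.v 1 = y)
    (χ : Φ.GradedChart S (P.fil x) (P.deg x)) (χ' : Φ.GradedChart S' (P.fil y) (P.deg y))
    (φ : S ⟶ S')
    (hφ : ∀ z ∈ Φ.F (P.fil x) (P.deg x),
      χ'.π₂ (Φ.d z) - φ.τ₂ (χ.π₂ z) ∈ LinearMap.range S'.f.hom) :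
    (Φ.page P 1).d x y ≫ χ'.iso.hom = χ.iso.hom ≫ ShortComplex.homologyMap φ := by
  refine ModuleCat.hom_ext (LinearMap.ext fun e => ?_)
  obtain ⟨z, rfl⟩ := Φ.cls_surjective _ _ _ e
  obtain ⟨c, hc, hec⟩ := χ.iso_cls z
  obtain ⟨c', hc', hec'⟩ := χ'.iso_cls
    ⟨Φ.d z, Φ.d_mem_Z (by rw [← h, P.fil_add]) (by rw [← h, P.deg_add]) z.2⟩
  have hn : ShortComplex.homologyMap φ (S.homologyπ c) =
      S'.homologyπ (ShortComplex.cyclesMap φ c) :=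
    congrArg (fun f => f.hom c) (ShortComplex.homologyπ_naturality φ)
  have hi : S'.iCycles (ShortComplex.cyclesMap φ c) = φ.τ₂ (S.iCycles c) :=
    congrArg (fun f => f.hom c) (ShortComplex.cyclesMap_i φ)
  calc
    _ = χ'.iso.hom (Φ.cls 1 _ _ _) := congrArg χ'.iso.hom (Φ.page_d_cls P h z)
    _ = S'.homologyπ c' := hec'
    _ = S'.homologyπ (ShortComplex.cyclesMap φ c) := by
      rw [ShortComplex.moduleCat_homologyπ_eq_iff, hi, hc, hc']
      exact hφ z z.2.1
    _ = ShortComplex.homologyMap φ (S.homologyπ c) := hn.symm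
    _ = _ := congrArg (ShortComplex.homologyMap φ) hec.symm

end FilteredDifferential

namespace Bicomplex

variable {k : Type u} [Field k] (M : Bicomplex.{u, v} k)

/-! ### The total complex inside the product of all components -/

/-- The differential `∂₁ + ∂₂` on the product of all the `M^{i,j}`. -/
def prodD : (∀ i j : ℤ, M.X i j) →ₗ[k] ∀ i j : ℤ, M.X i j where
  toFun t i j := M.d₁ (i - 1) i j (by lia) (t (i - 1) j) + M.d₂ i (j - 1) j (by lia) (t i (j - 1))
  map_add' s t := by
    funext i j
    simp only [Pi.add_apply, map_add]
    abel
  map_smul' c t := by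
    funext i j
    simp only [Pi.smul_apply, map_smul, RingHom.id_apply, smul_add]

lemma prodD_apply (t : ∀ i j : ℤ, M.X i j) (i i' j j' : ℤ) (hi : i' + 1 = i) (hj : j' + 1 = j) :
    M.prodD t i j = M.d₁ i' i j hi (t i' j) + M.d₂ i j' j hj (t i j') := by
  obtain rfl : i' = i - 1 := by lia
  obtain rfl : j' = j - 1 := by lia
  rfl

lemma d₁_d₁_apply (i i' i'' j : ℤ) (h : i + 1 = i') (h' : i' + 1 = i'') (m : M.X i j) :
    M.d₁ i' i'' j h' (M.d₁ i i' j h m) = 0 :=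
  congrArg (fun f => f.hom m) (M.d₁_d₁ i i' i'' j h h')

lemma d₂_d₂_apply (i j j' j'' : ℤ) (h : j + 1 = j') (h' : j' + 1 = j'') (m : M.X i j) :
    M.d₂ i j' j'' h' (M.d₂ i j j' h m) = 0 :=
  congrArg (fun f => f.hom m) (M.d₂_d₂ i j j' j'' h h')

lemma anticomm_apply (i i' j j' : ℤ) (h : i + 1 = i') (h' : j + 1 = j') (m : M.X i j) :
    M.d₁ i i' j' h (M.d₂ i j j' h' m) + M.d₂ i' j j' h' (M.d₁ i i' j h m) = 0 :=
  congrArg (fun f => f.hom m) (M.anticomm i i' j j' h h')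

lemma prodD_prodD (t : ∀ i j : ℤ, M.X i j) : M.prodD (M.prodD t) = 0 := by
  funext i j
  rw [M.prodD_apply _ i (i - 1) j (j - 1) (by lia) (by lia),
    M.prodD_apply t (i - 1) (i - 1 - 1) j (j - 1) (by lia) (by lia),
    M.prodD_apply t i (i - 1) (j - 1) (j - 1 - 1) (by lia) (by lia), map_add, map_add,
    d₁_d₁_apply, d₂_d₂_apply, zero_add, add_zero, anticomm_apply]
  rfl

/-- The inclusion of `Tot^n(M)` in the product of all the `M^{i,j}`. -/
def totToProd (n : ℤ) : M.Tot n →ₗ[k] ∀ i j : ℤ, M.X i j :=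
  LinearMap.pi fun i => LinearMap.pi fun j =>
    if h : i + j = n then
      DirectSum.component k {x : ℤ × ℤ // x.1 + x.2 = n} (fun x => M.X x.1.1 x.1.2) ⟨(i, j), h⟩
    else 0

lemma totToProd_apply {n : ℤ} (t : M.Tot n) {i j : ℤ} (h : i + j = n) :
    M.totToProd n t i j = t ⟨(i, j), h⟩ := by
  simp only [totToProd, LinearMap.pi_apply, dif_pos h]
  rfl

lemma totToProd_apply_of_ne {n : ℤ} (t : M.Tot n) {i j : ℤ} (h : i + j ≠ n) :
    M.totToProd n t i j = 0 := by
  simp only [totToProd, LinearMap.pi_apply, dif_neg h, LinearMap.zero_apply]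

lemma totToProd_injective (n : ℤ) : Function.Injective (M.totToProd n) := by
  intro s t h
  refine DFinsupp.ext fun ⟨⟨i, j⟩, hx⟩ => ?_
  have := congrFun (congrFun h i) j
  rwa [totToProd_apply _ _ hx, totToProd_apply _ _ hx] at this

lemma totToProd_ιTot (i j n : ℤ) (h : i + j = n) (m : M.X i j) :
    M.totToProd n (M.ιTot i j n h m) i j = m := by
  rw [totToProd_apply _ _ h]
  exact DirectSum.lof_apply _ _ _

lemma totToProd_ιTot_of_ne (i j n : ℤ) (h : i + j = n) (m : M.X i j) (i' j' : ℤ)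
    (hne : ¬ (i = i' ∧ j = j')) : M.totToProd n (M.ιTot i j n h m) i' j' = 0 := by
  by_cases h' : i' + j' = n
  · rw [totToProd_apply _ _ h']
    exact DFinsupp.single_eq_of_ne fun e => hne
      ⟨(congrArg (·.1.1) e).symm, (congrArg (·.1.2) e).symm⟩
  · exact M.totToProd_apply_of_ne _ h'

lemma totToProd_ιTot_d₁ (i₀ i i' j n : ℤ) (h : i + j = n) (h₀ : i₀ + 1 = i) (h₀' : i₀ + 1 = i')
    (m : M.X i₀ j) :
    M.totToProd n (M.ιTot i j n h (M.d₁ i₀ i j h₀ m)) i' j = M.d₁ i₀ i' j h₀' m := by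
  subst h₀ h₀'
  exact M.totToProd_ιTot _ _ _ _ _

lemma totToProd_ιTot_d₂ (i j₀ j j' n : ℤ) (h : i + j = n) (h₀ : j₀ + 1 = j) (h₀' : j₀ + 1 = j')
    (m : M.X i j₀) :
    M.totToProd n (M.ιTot i j n h (M.d₂ i j₀ j h₀ m)) i j' = M.d₂ i j₀ j' h₀' m := by
  subst h₀ h₀'
  exact M.totToProd_ιTot _ _ _ _ _

lemma prodD_totToProd (n n' : ℤ) (h : n + 1 = n') (t : M.Tot n) :
    M.prodD (M.totToProd n t) = M.totToProd n' (M.totD n n' h t) := by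
  refine LinearMap.congr_fun (f := M.prodD ∘ₗ M.totToProd n)
    (g := M.totToProd n' ∘ₗ M.totD n n' h) (DirectSum.linearMap_ext _ ?_) t
  rintro ⟨⟨i, j⟩, hij⟩
  refine LinearMap.ext fun m => ?_
  change M.prodD (M.totToProd n (M.ιTot i j n hij m)) =
    M.totToProd n' (M.totD n n' h (M.ιTot i j n hij m))
  rw [totD_ιTot, map_add]
  funext i' j'
  change _ = M.totToProd n' _ i' j' + M.totToProd n' _ i' j'
  rw [M.prodD_apply _ i' (i' - 1) j' (j' - 1) (by lia) (by lia)]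
  congr 1
  · by_cases hc : i = i' - 1 ∧ j = j'
    · obtain ⟨rfl, rfl⟩ := hc
      rw [totToProd_ιTot]
      exact (M.totToProd_ιTot_d₁ _ _ _ _ _ _ _ _ _).symm
    · rw [M.totToProd_ιTot_of_ne _ _ _ _ _ _ _ hc, map_zero,
        M.totToProd_ιTot_of_ne _ _ _ _ _ _ _ (by lia)]
  · by_cases hc : i = i' ∧ j = j' - 1
    · obtain ⟨rfl, rfl⟩ := hc
      rw [totToProd_ιTot]
      exact (M.totToProd_ιTot_d₂ _ _ _ _ _ _ _ _ _).symm
    · rw [M.totToProd_ιTot_of_ne _ _ _ _ _ _ _ hc, map_zero,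
        M.totToProd_ιTot_of_ne _ _ _ _ _ _ _ (by lia)]

/-! ### The filtrations of the total complex -/

/-- A weight on the positions of a bicomplex that the differentials do not decrease. -/
structure Weight where
  w : ℤ × ℤ → ℤ
  le₁ : ∀ i j, w (i, j) ≤ w (i + 1, j)
  le₂ : ∀ i j, w (i, j) ≤ w (i, j + 1)

/-- The weight whose filtration is the one by columns. -/
def Weight.column : Weight := ⟨fun x => x.1, fun i _ => by simp, fun _ _ => le_rfl⟩

/-- The weight whose filtration is the one by rows. -/
def Weight.row : Weight := ⟨fun x => x.2, fun _ _ => le_rfl, fun _ j => by simp⟩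

variable (W : Weight)

/-- The elements of `Tot^n(M)` of weight at least `p`. -/
abbrev weightFiltration (p n : ℤ) : Submodule k (M.total.X n) := M.supportedIn {x | p ≤ W.w x} n

/-- The image of the weight filtration in the product of all the `M^{i,j}`. -/
def prodF (p n : ℤ) : Submodule k (∀ i j : ℤ, M.X i j) :=
  (M.weightFiltration W p n).map (M.totToProd n)

variable {W} in
lemma apply_eq_zero_of_mem_prodF {p n : ℤ} {a : ∀ i j : ℤ, M.X i j} (ha : a ∈ M.prodF W p n)
    {i j : ℤ} (h : W.w (i, j) < p) : a i j = 0 := by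
  obtain ⟨t, ht, rfl⟩ := ha
  by_cases hn : i + j = n
  · rw [totToProd_apply _ _ hn]
    exact ht ⟨(i, j), hn⟩ (not_le.2 h)
  · exact M.totToProd_apply_of_ne _ hn

variable {W} in
-- Membership in some filtration step already provides the lift to the direct sum; only the
-- vanishing of components remains to be checked.
lemma mem_prodF_of_mem {p q n : ℤ} {a : ∀ i j : ℤ, M.X i j} (ha : a ∈ M.prodF W p n)
    (h : ∀ i j, i + j = n → W.w (i, j) < q → a i j = 0) : a ∈ M.prodF W q n := by
  obtain ⟨t, ht, rfl⟩ := ha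
  refine ⟨t, fun ⟨⟨i, j⟩, hn⟩ hx => ?_, rfl⟩
  have := h i j hn (not_le.1 hx)
  rwa [totToProd_apply _ _ hn] at this

lemma exists_mem_prodF (i j n p : ℤ) (hn : i + j = n) (hp : p ≤ W.w (i, j)) (m : M.X i j) :
    ∃ a ∈ M.prodF W p n, a i j = m := by
  refine ⟨_, ⟨M.ιTot i j n hn m, fun x hx => ?_, rfl⟩, M.totToProd_ιTot i j n hn m⟩
  refine DFinsupp.single_eq_of_ne fun e => hx ?_
  rw [e]
  exact hp

/-- The product of the components with the differential `∂₁ + ∂₂` and the filtration by weight. -/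
def filteredDifferential : FilteredDifferential k (∀ i j : ℤ, M.X i j) where
  d := M.prodD
  F := M.prodF W
  d_d := M.prodD_prodD
  F_succ_le p n a ha := M.mem_prodF_of_mem ha fun i j _ h =>
    M.apply_eq_zero_of_mem_prodF ha (by lia)
  d_mem p n a ha := by
    obtain ⟨t, ht, rfl⟩ := ha
    refine ⟨M.totD n (n + 1) rfl t, fun ⟨⟨i, j⟩, hn⟩ hx => ?_,
      (M.prodD_totToProd n (n + 1) rfl t).symm⟩
    have hx' : W.w (i, j) < p := not_le.1 hx
    -- The (i, j) component of the differential comes from (i - 1, j) and (i, j - 1), whose weights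
    -- are no larger.
    have h₁ := W.le₁ (i - 1) j
    have h₂ := W.le₂ i (j - 1)
    rw [sub_add_cancel] at h₁ h₂
    have ha : M.totToProd n t ∈ M.prodF W p n := ⟨t, ht, rfl⟩
    change (M.totD n (n + 1) rfl t) ⟨(i, j), hn⟩ = 0
    rw [← M.totToProd_apply, ← prodD_totToProd,
      M.prodD_apply _ i (i - 1) j (j - 1) (by lia) (by lia),
      M.apply_eq_zero_of_mem_prodF ha (by lia), M.apply_eq_zero_of_mem_prodF ha (by lia),
      map_zero, map_zero, add_zero]

/-- The total complex with the filtration by weight realizes the filtered differential module. -/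
def realization :
    (M.filteredDifferential W).Realization M.total (M.weightFiltration W) where
  ι n := M.totToProd n
  injective n := M.totToProd_injective n
  d_ι n n' h t := by
    refine (M.prodD_totToProd n n' h t).trans ?_
    have : M.total.d n n' = ModuleCat.ofHom (M.totD n n' h) := dif_pos h
    rw [this]
    rfl
  F_eq _ _ := rfl

lemma exists_mem_weightFiltration (n : ℤ) (t : M.total.X n) :
    ∃ p, t ∈ M.weightFiltration W p n := by
  classical
  obtain ⟨p, hp⟩ := ((DFinsupp.support (show M.Tot n from t)).image fun x => W.w x.1).bddBelow
  refine ⟨p, fun x hx => ?_⟩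
  by_contra h
  exact hx (hp (Finset.mem_coe.2 (Finset.mem_image_of_mem _ (DFinsupp.mem_support_iff.2 h))))

lemma weightFiltration_eq_bot {p n : ℤ}
    (h : ∀ i j, i + j = n → p ≤ W.w (i, j) → Subsingleton (M.X i j)) :
    M.weightFiltration W p n = ⊥ := by
  refine eq_bot_iff.2 fun t ht => DFinsupp.ext fun ⟨⟨i, j⟩, hn⟩ => ?_
  by_cases hp : p ≤ W.w (i, j)
  · have := h i j hn hp
    exact Subsingleton.elim _ _
  · exact ht ⟨(i, j), hn⟩ hp

/-! ### The two first pages -/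

/-- The component `M^{i,j}` of the product. -/
def prodComponent (i j : ℤ) : (∀ i j : ℤ, M.X i j) →ₗ[k] M.X i j :=
  LinearMap.proj (φ := fun j => M.X i j) j ∘ₗ LinearMap.proj (φ := fun i => ∀ j, M.X i j) i

/-- The positions of the spectral sequence of the filtration by columns. -/
def columnPositions : FilteredDifferential.Positions (ℤ × ℤ) where
  v r := (r, 1 - r)
  fil x := x.1
  deg x := x.1 + x.2
  fil_add _ _ := rfl
  deg_add x r := by change x.1 + r + (x.2 + (1 - r)) = _; ring

/-- The positions of the spectral sequence of the filtration by rows. -/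
def rowPositions : FilteredDifferential.Positions (ℤ × ℤ) where
  v r := (1 - r, r)
  fil x := x.2
  deg x := x.1 + x.2
  fil_add _ _ := rfl
  deg_add x r := by change x.1 + (1 - r) + (x.2 + r) = _; ring

/-- In a fixed total degree, column p contains just one position, so a single coordinate separates
F^p from F^{p+1}. -/
lemma column_mem_iff {p n i j : ℤ} (hi : i = p) (hn : i + j = n) {a : ∀ i j : ℤ, M.X i j}
    (ha : a ∈ M.prodF .column p n) : a i j = 0 ↔ a ∈ M.prodF .column (p + 1) n := by
  subst hi
  refine ⟨fun h => M.mem_prodF_of_mem ha fun i' j' hn' hw => ?_,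
    fun h => M.apply_eq_zero_of_mem_prodF h (by simp [Weight.column])⟩
  change i' < i + 1 at hw
  rcases (Int.lt_add_one_iff.1 hw).lt_or_eq with hlt | rfl
  · exact M.apply_eq_zero_of_mem_prodF ha hlt
  · obtain rfl : j = j' := by lia
    exact h

lemma row_mem_iff {p n i j : ℤ} (hj : j = p) (hn : i + j = n) {a : ∀ i j : ℤ, M.X i j}
    (ha : a ∈ M.prodF .row p n) : a i j = 0 ↔ a ∈ M.prodF .row (p + 1) n := by
  subst hj
  refine ⟨fun h => M.mem_prodF_of_mem ha fun i' j' hn' hw => ?_,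
    fun h => M.apply_eq_zero_of_mem_prodF h (by simp [Weight.row])⟩
  change j' < j + 1 at hw
  rcases (Int.lt_add_one_iff.1 hw).lt_or_eq with hlt | rfl
  · exact M.apply_eq_zero_of_mem_prodF ha hlt
  · obtain rfl : i = i' := by lia
    exact h

/-- The column `i` in the coordinates of the filtration by columns. -/
def columnChart (i j : ℤ) :
    (M.filteredDifferential .column).GradedChart (M.sc₂ i j)
      (columnPositions.fil (i, j)) (columnPositions.deg (i, j)) where
  π₁ := M.prodComponent i (j - 1)
  π₂ := M.prodComponent i j
  π₃ := M.prodComponent i (j + 1)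
  exists_π₁ m := M.exists_mem_prodF .column i (j - 1) (i + j - 1) i (by lia) le_rfl m
  exists_π₂ m := M.exists_mem_prodF .column i j _ i rfl le_rfl m
  π₂_eq_zero_iff _ ha := M.column_mem_iff rfl rfl ha
  π₃_eq_zero_iff _ ha := M.column_mem_iff rfl (add_assoc i j 1).symm ha
  π₂_d a ha := by
    change M.prodD a i j = M.d₂ i (j - 1) j _ (a i (j - 1))
    rw [M.prodD_apply a i (i - 1) j (j - 1) (by lia) (by lia),
      M.apply_eq_zero_of_mem_prodF ha (sub_one_lt i), map_zero, zero_add]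
  π₃_d a ha := by
    change M.prodD a i (j + 1) = M.d₂ i j (j + 1) _ (a i j)
    rw [M.prodD_apply a i (i - 1) (j + 1) j (by lia) (by lia),
      M.apply_eq_zero_of_mem_prodF ha (sub_one_lt i), map_zero, zero_add]

/-- The row `j` in the coordinates of the filtration by rows. -/
def rowChart (i j : ℤ) :
    (M.filteredDifferential .row).GradedChart (M.sc₁ i j)
      (rowPositions.fil (i, j)) (rowPositions.deg (i, j)) where
  π₁ := M.prodComponent (i - 1) j
  π₂ := M.prodComponent i j
  π₃ := M.prodComponent (i + 1) j
  exists_π₁ m := M.exists_mem_prodF .row (i - 1) j (i + j - 1) j (by lia) le_rfl m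
  exists_π₂ m := M.exists_mem_prodF .row i j _ j rfl le_rfl m
  π₂_eq_zero_iff _ ha := M.row_mem_iff rfl rfl ha
  π₃_eq_zero_iff _ ha := M.row_mem_iff rfl (add_right_comm i 1 j) ha
  π₂_d a ha := by
    change M.prodD a i j = M.d₁ (i - 1) i j _ (a (i - 1) j)
    rw [M.prodD_apply a i (i - 1) j (j - 1) (by lia) (by lia),
      M.apply_eq_zero_of_mem_prodF ha (sub_one_lt j), map_zero, add_zero]
  π₃_d a ha := by
    change M.prodD a (i + 1) j = M.d₁ i (i + 1) j _ (a i j)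
    rw [M.prodD_apply a (i + 1) i j (j - 1) (by lia) (by lia),
      M.apply_eq_zero_of_mem_prodF ha (sub_one_lt j), map_zero, add_zero]

/-- The first page of the spectral sequence of the filtration by columns. -/
def columnPageIso (i j : ℤ) :
    ((M.filteredDifferential .column).page columnPositions 1).X (i, j) ≅ M.H₂ i j :=
  (M.columnChart i j).iso

lemma page_d_columnPageIso (i j : ℤ) :
    ((M.filteredDifferential .column).page columnPositions 1).d (i, j) (i + 1, j) ≫
      (M.columnPageIso (i + 1) j).hom = (M.columnPageIso i j).hom ≫ M.inducedD₁ i j :=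
  FilteredDifferential.GradedChart.page_d_iso columnPositions (by simp [columnPositions])
    (M.columnChart i j) (M.columnChart (i + 1) j) (M.sc₂Map i j) fun z _ => by
    -- The (i + 1, j) component of dz is ∂₁ z_{i,j} + ∂₂ z_{i+1,j-1}; the second term is a boundary
    -- for ∂₂.
    refine ⟨z (i + 1) (j - 1), ?_⟩
    change _ = M.prodD z (i + 1) j - M.d₁ i (i + 1) j rfl (z i j)
    rw [M.prodD_apply _ (i + 1) i j (j - 1) rfl (by lia), add_sub_cancel_left]
    rfl

/-- The first page of the spectral sequence of the filtration by rows. -/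
def rowPageIso (i j : ℤ) :
    ((M.filteredDifferential .row).page rowPositions 1).X (i, j) ≅ M.H₁ i j :=
  (M.rowChart i j).iso

lemma page_d_rowPageIso (i j : ℤ) :
    ((M.filteredDifferential .row).page rowPositions 1).d (i, j) (i, j + 1) ≫
      (M.rowPageIso i (j + 1)).hom = (M.rowPageIso i j).hom ≫ M.inducedD₂ i j :=
  FilteredDifferential.GradedChart.page_d_iso rowPositions (by simp [rowPositions])
    (M.rowChart i j) (M.rowChart i (j + 1)) (M.sc₁Map i j) fun z _ => by
    refine ⟨z (i - 1) (j + 1), ?_⟩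
    change _ = M.prodD z i (j + 1) - M.d₂ i j (j + 1) rfl (z i j)
    rw [M.prodD_apply _ i (i - 1) (j + 1) j (by lia) rfl, add_sub_cancel_right]
    rfl

end Bicomplex

end

/-! ### The two spectral sequences of a bicomplex -/

theorem mainTheorem6 {k : Type u} [Field k] (M : Bicomplex.{u, v} k) :
    (M.BoundedFromSoutheast →
      ∃ (E : SpectralSequence (ModuleCat.{v} k)
          (fun r : ℤ => ComplexShape.up' ((r, 1 - r) : ℤ × ℤ)) 1)
        (e : ∀ i j : ℤ, (E.page 1 le_rfl).X (i, j) ≅ M.H₂ i j),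
        (∀ i j : ℤ, (E.page 1 le_rfl).d (i, j) (i + 1, j) ≫ (e (i + 1) j).hom =
          (e i j).hom ≫ M.inducedD₁ i j) ∧
        SpecSeq.ConvergesTo E (fun x => x.1) (fun x => x.1 + x.2)
          M.totalCohomology M.columnFiltration) ∧
    (M.BoundedFromNorthwest →
      ∃ (E : SpectralSequence (ModuleCat.{v} k)
          (fun r : ℤ => ComplexShape.up' ((1 - r, r) : ℤ × ℤ)) 1)
        (e : ∀ i j : ℤ, (E.page 1 le_rfl).X (i, j) ≅ M.H₁ i j),
        (∀ i j : ℤ, (E.page 1 le_rfl).d (i, j) (i, j + 1) ≫ (e i (j + 1)).hom =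
          (e i j).hom ≫ M.inducedD₂ i j) ∧
        SpecSeq.ConvergesTo E (fun x => x.2) (fun x => x.1 + x.2)
          M.totalCohomology M.rowFiltration) := by
  refine ⟨fun ⟨a, b, h⟩ => ?_, fun ⟨a, b, h⟩ => ?_⟩
  · refine ⟨(M.filteredDifferential .column).spectralSequence Bicomplex.columnPositions 1,
      M.columnPageIso, M.page_d_columnPageIso,
      (M.realization .column).convergesTo Bicomplex.columnPositions 1
        -- If i ≥ max a (n - b), then i ≥ a and j = n - i ≤ b, so the position lies in the vanishing
        -- Southeast corner.
        (M.exists_mem_weightFiltration .column) fun n => ⟨max a (n - b), ?_⟩⟩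
    refine M.weightFiltration_eq_bot .column fun i j hn hi => ?_
    change max a (n - b) ≤ i at hi
    exact h i j (by lia) (by lia)
  · refine ⟨(M.filteredDifferential .row).spectralSequence Bicomplex.rowPositions 1,
      M.rowPageIso, M.page_d_rowPageIso,
      (M.realization .row).convergesTo Bicomplex.rowPositions 1
        (M.exists_mem_weightFiltration .row) fun n => ⟨max b (n - a), ?_⟩⟩
    refine M.weightFiltration_eq_bot .row fun i j hn hj => ?_
    change max b (n - a) ≤ j at hj
    exact h i j (by lia) (by lia)
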